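/- **Theorem 5.** For $d\ge 1$, $\sigma>0$ and $\theta\in\mathbb R^d$, let $\mathbf E_\theta$ denote the expectation when $y=(y_1,\dots,y_d)$ is observed, where $y_j=\theta_j+\sigma\xi_j$ and $\xi_1,\dots,\xi_d$ are i.i.d. standard normal. Let $Q(\theta)=\sum_{i=1}^d\theta_i^2$, for $q,r>0$ let $B_q(r)=\{\theta\in\mathbb R^d:\ (\sum_{i=1}^d|\theta_i|^q)^{1/q}\le r\}$, and let $$R_Q^*(B_q(r))=\inf_{\hat T}\ \sup_{\theta\in B_q(r)}\mathbf E_\theta\big(\hat T-Q(\theta)\big)^2,$$ where the infimum is over all estimators, i.e. all measurable functions $\hat T=\hat T(y)\in\mathbb R$. Let $m=m(d,r,\sigma,q)\in\{0,1,2,\dots\}\cup\{\infty\}$ be the largest integer $s\ge 0$ such that $$\sigma^2\log(1+d/k^2)\le r^2k^{-2/q}\qquad\text{for every integer } k \text{ with } 1\le k\le s,$$ with $m=\infty$ if this inequality holds for every integer $k\ge1$ (so $m=0$ if it fails for $k=1$). Put $$\psi^Q_{\sigma,q}(r,d)=\begin{cases}\max\{\sigma^2r^2,\ \sigma^4d\}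 & \text{if } m>\sqrt d,\\ \max\{\sigma^2r^2,\ \sigma^4m^2\log^2(1+d/m^2)\} & \text{if } 1\le m\le\sqrt d,\\ r^4 & \text{if } m=0.\end{cases}$$ Let $0<q<2$. Then there exists a constant $c>0$, depending only on $q$, such that for every integer $d\ge1$ and all $r,\sigma>0$, $$R_Q^*(B_q(r))\ \ge\ c\,\psi^Q_{\sigma,q}(r,d).$$ -/

import Mathlib

open MeasureTheory ProbabilityTheory
open scoped ENNReal

noncomputable section

namespace SparseSequence

/-- The quadratic functional `Q(θ) = ∑ θ_i²`. -/
def quadFunctional {d : ℕ} (θ : Fin d → ℝ) : ℝ := ∑ i, θ i ^ 2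

/-- The `ℓ_q` ball `B_q(r) = {θ ∈ ℝ^d : ‖θ‖_q ≤ r}` with `‖θ‖_q = (∑ |θ_i|^q)^{1/q}`. -/
def lqBall (d : ℕ) (q r : ℝ) : Set (Fin d → ℝ) :=
  {θ | (∑ i, |θ i| ^ q) ^ (1 / q) ≤ r}

/-- `P_θ`, the law of the observation `y = (y_1, …, y_d)`, `y_j = θ_j + σ ξ_j` with `ξ_j` i.i.d.
standard normal: it is the law of `θ + σ ξ` when `ξ` has the standard normal law on `ℝ^d`. -/
def obsLaw {d : ℕ} (σ : ℝ) (θ : Fin d → ℝ) : Measure (Fin d → ℝ) :=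
  (Measure.pi fun _ : Fin d => gaussianReal 0 1).map fun ξ j => θ j + σ * ξ j

/-- The squared risk `E_θ (T̂ - T(θ))²`, as a value in `[0, ∞]`. -/
def sqRisk {d : ℕ} (σ : ℝ) (T : (Fin d → ℝ) → ℝ) (That : (Fin d → ℝ) → ℝ) (θ : Fin d → ℝ) :
    ℝ≥0∞ :=
  ∫⁻ y, ENNReal.ofReal ((That y - T θ) ^ 2) ∂(obsLaw σ θ)

/-- The minimax risk `R*_T(Θ) = inf_{T̂} sup_{θ ∈ Θ} E_θ (T̂ - T(θ))²`, the infimum being over all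
estimators, that is, all measurable real functions of the observation. -/
def minimaxRisk {d : ℕ} (σ : ℝ) (T : (Fin d → ℝ) → ℝ) (Θ : Set (Fin d → ℝ)) : ℝ≥0∞ :=
  ⨅ (That : (Fin d → ℝ) → ℝ) (_ : Measurable That), ⨆ θ ∈ Θ, sqRisk σ T That θ

/-- The inequality `σ² log(1 + d/s²) ≤ r² s^{-2/q}` that defines the effective sparsity. -/
def SparsityIneq (σ q r : ℝ) (d s : ℕ) : Prop :=
  σ ^ 2 * Real.log (1 + (d : ℝ) / (s : ℝ) ^ 2) ≤ r ^ 2 * (s : ℝ) ^ (-(2 / q))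

/-- The effective sparsity `m`: the largest integer `s ≥ 0` such that the inequality holds at
every integer `k` with `1 ≤ k ≤ s`, and `m = ∞` if it holds at every integer `k ≥ 1`.
In particular `m = 0` when it fails at `1`. For `q < 1` the function
`s ↦ s^{2/q} log(1 + d/s²)` increases to infinity, and `m` is the largest `s ≥ 1` that satisfies
the inequality (`0` if there is none). -/
def effSparsity (σ q r : ℝ) (d : ℕ) : ℕ∞ :=
  ⨆ s ∈ {s : ℕ | ∀ k : ℕ, 1 ≤ k → k ≤ s → SparsityIneq σ q r d k}, (s : ℕ∞)

open Classical in
/-- The rate `ψ^Q_{σ,q}(r,d)`: `r⁴` in the degenerate zone `m = 0`, `max(σ² r², σ⁴ d)` in the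
dense zone `m > √d`, and `max(σ² r², σ⁴ m² log²(1 + d/m²))` in the sparse zone `1 ≤ m ≤ √d`
(where `m` is finite, so that `m.toNat` is `m`). -/
def quadRate (σ q r : ℝ) (d : ℕ) : ℝ :=
  let m : ℕ∞ := effSparsity σ q r d
  if m = 0 then r ^ 4
  else if ENNReal.ofReal (√(d : ℝ)) < (m : ℝ≥0∞) then max (σ ^ 2 * r ^ 2) (σ ^ 4 * d)
  else max (σ ^ 2 * r ^ 2)
    (σ ^ 4 * (m.toNat : ℝ) ^ 2 * Real.log (1 + (d : ℝ) / (m.toNat : ℝ) ^ 2) ^ 2)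

end SparseSequence

end

/-!
Fix `θ₀` and a prior `π` on the parameter set under which `Q(θ)` is at distance `Δ` from `Q(θ₀)`.
If the second moment under `P_{θ₀}` of the likelihood ratio of the mixture `∫ P_θ dπ(θ)` is at most
`C²`, then no estimator has risk below `(Δ / (1 + C))²`: an estimator of risk `R` under the mixture
has `|T̂ - Q(θ₀)|` of mean at least `Δ - √R` there, whereas by Cauchy–Schwarz this mean is at most
`C √R`. For Gaussian shifts that second moment is the average of `exp(⟨θ - θ₀, θ' - θ₀⟩ / σ²)` over
independent `θ, θ' ∼ π`.

Taking `θ₀ = 0` and for `π` the law of `s` spikes of height `a`, each uniformly placed in its own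
block of `b` coordinates, turns this average into `(1 + (exp(a² / σ²) - 1) / b) ^ s`, while
`Δ = s a²`. The terms of the rate come from

* `s = m`, or `s = ⌊√d⌋` in the dense zone, with `a² = σ² log(1 + d/s²)` and `b = ⌊d/s⌋`; the
  inequality defining `m` says exactly that these spikes fit in the ball;
* `s = 1`, `a = r`, `b = d` when `m = 0`;
* the two points `r - σ/2` and `r` on a coordinate axis for `σ² r²`.
-/

noncomputable section

namespace SparseSequence

open scoped NNReal

/-! ### Product measures -/

section ProductMeasures

variable {ι : Type*} [Fintype ι] {X : ι → Type*} [∀ i, MeasurableSpace (X i)]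
  (μ : ∀ i, Measure (X i)) [∀ i, IsProbabilityMeasure (μ i)] {f : ∀ i, X i → ℝ≥0∞}

theorem lintegral_pi_prod_eval (hf : ∀ i, Measurable (f i)) :
    ∫⁻ x, ∏ i, f i (x i) ∂(Measure.pi μ) = ∏ i, ∫⁻ x, f i x ∂(μ i) := by
  refine (lintegral_prod_eq_prod_lintegral_of_indepFun (μ := Measure.pi μ) Finset.univ
    (fun i (x : ∀ i, X i) => f i (x i)) (iIndepFun_pi fun i => (hf i).aemeasurable)
    fun i => (hf i).comp (measurable_pi_apply i)).trans ?_
  exact Finset.prod_congr rfl fun i _ => (measurePreserving_eval μ i).lintegral_comp (hf i)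

theorem pi_withDensity [∀ i, SigmaFinite ((μ i).withDensity (f i))]
    (hf : ∀ i, Measurable (f i)) :
    Measure.pi (fun i => (μ i).withDensity (f i)) =
      (Measure.pi μ).withDensity fun x => ∏ i, f i (x i) := by
  refine Measure.pi_eq fun s hs => ?_
  have indicator_prod (x : ∀ i, X i) :
      (Set.univ.pi s).indicator (fun x => ∏ i, f i (x i)) x =
        ∏ i, (s i).indicator (f i) (x i) := by
    by_cases hx : x ∈ Set.univ.pi s
    · rw [Set.indicator_of_mem hx]
      exact Finset.prod_congr rfl fun i _ => (Set.indicator_of_mem (hx i trivial) _).symm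
    · obtain ⟨i, hi⟩ : ∃ i, x i ∉ s i := by simpa [Set.mem_pi] using hx
      rw [Set.indicator_of_notMem hx,
        Finset.prod_eq_zero (Finset.mem_univ i) (Set.indicator_of_notMem hi _)]
  rw [withDensity_apply _ (MeasurableSet.univ_pi hs),
    ← lintegral_indicator (MeasurableSet.univ_pi hs)]
  simp_rw [indicator_prod]
  rw [lintegral_pi_prod_eval μ fun i => (hf i).indicator (hs i)]
  exact Finset.prod_congr rfl fun i _ => by
    rw [lintegral_indicator (hs i), withDensity_apply _ (hs i)]

end ProductMeasures

/-! ### Gaussian likelihood ratios -/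

theorem gaussianReal_eq_withDensity_gaussianReal {v : ℝ≥0} (hv : v ≠ 0) (m₀ m : ℝ) :
    gaussianReal m v = (gaussianReal m₀ v).withDensity fun x =>
      ENNReal.ofReal (Real.exp ((m - m₀) * (x - m₀) / v - (m - m₀) ^ 2 / (2 * v))) := by
  have hv' : (v : ℝ) ≠ 0 := by exact_mod_cast hv
  rw [gaussianReal_of_var_ne_zero _ hv, gaussianReal_of_var_ne_zero _ hv,
    ← withDensity_mul _ (measurable_gaussianPDF _ _) (by fun_prop)]
  congr 1 with x
  simp only [Pi.mul_apply, gaussianPDF]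
  rw [← ENNReal.ofReal_mul (gaussianPDFReal_nonneg m₀ v x)]
  simp only [gaussianPDFReal]
  rw [mul_assoc _⁻¹, ← Real.exp_add]
  congr 3
  field_simp
  ring

section GaussianShift

variable {d : ℕ} {σ : ℝ}

theorem obsLaw_eq_pi (σ : ℝ) (θ : Fin d → ℝ) :
    obsLaw σ θ = Measure.pi fun j => gaussianReal (θ j) (.mk (σ ^ 2) (sq_nonneg σ)) := by
  rw [obsLaw, Measure.pi_map_pi (f := fun j x => θ j + σ * x) fun j => by fun_prop]
  congr 1 with j : 1
  rw [show (fun x => θ j + σ * x) = (θ j + ·) ∘ (σ * ·) from rfl,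
    ← Measure.map_map (by fun_prop) (by fun_prop), gaussianReal_map_const_mul,
    gaussianReal_map_const_add, mul_zero, zero_add, mul_one]

instance isProbabilityMeasure_obsLaw (σ : ℝ) (θ : Fin d → ℝ) :
    IsProbabilityMeasure (obsLaw σ θ) := by
  rw [obsLaw_eq_pi]
  infer_instance

/-- The likelihood ratio `dP_θ / dP_{θ₀}` of the Gaussian sequence model, at the observation `y`. -/
def likelihoodRatio (σ : ℝ) (θ₀ θ y : Fin d → ℝ) : ℝ≥0∞ :=
  ENNReal.ofReal (Real.exp
    (∑ j, ((θ j - θ₀ j) * (y j - θ₀ j) / σ ^ 2 - (θ j - θ₀ j) ^ 2 / (2 * σ ^ 2))))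

theorem measurable_likelihoodRatio {ι : Type*} [MeasurableSpace ι] (σ : ℝ) (θ₀ : Fin d → ℝ)
    {θ : ι → Fin d → ℝ} (hθ : Measurable θ) :
    Measurable (Function.uncurry fun i => likelihoodRatio σ θ₀ (θ i)) := by
  unfold likelihoodRatio Function.uncurry
  fun_prop

theorem obsLaw_eq_withDensity (hσ : σ ≠ 0) (θ₀ θ : Fin d → ℝ) :
    obsLaw σ θ = (obsLaw σ θ₀).withDensity (likelihoodRatio σ θ₀ θ) := by
  have hv : NNReal.mk (σ ^ 2) (sq_nonneg σ) ≠ 0 := fun h =>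
    pow_ne_zero 2 hσ (congrArg NNReal.toReal h)
  have shift (j : Fin d) := gaussianReal_eq_withDensity_gaussianReal hv (θ₀ j) (θ j)
  have (j : Fin d) : SigmaFinite _ :=
    (shift j).subst (motive := fun P => SigmaFinite P) inferInstance
  simp_rw [obsLaw_eq_pi, shift]
  rw [pi_withDensity _ fun j => by fun_prop]
  congr 1 with y
  rw [likelihoodRatio, Real.exp_sum, ENNReal.ofReal_prod_of_nonneg fun j _ => (Real.exp_pos _).le]
  rfl

theorem lintegral_likelihoodRatio (hσ : σ ≠ 0) (θ₀ θ : Fin d → ℝ) :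
    ∫⁻ y, likelihoodRatio σ θ₀ θ y ∂(obsLaw σ θ₀) = 1 := by
  rw [← setLIntegral_univ, ← withDensity_apply _ MeasurableSet.univ,
    ← obsLaw_eq_withDensity hσ, measure_univ]

-- Completing the square: the product of the ratios at `θ` and `θ'` is a constant multiple of the
-- ratio at `θ + θ' - θ₀`.
theorem lintegral_likelihoodRatio_mul_likelihoodRatio (hσ : σ ≠ 0) (θ₀ θ θ' : Fin d → ℝ) :
    ∫⁻ y, likelihoodRatio σ θ₀ θ y * likelihoodRatio σ θ₀ θ' y ∂(obsLaw σ θ₀) =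
      ENNReal.ofReal (Real.exp (∑ j, (θ j - θ₀ j) * (θ' j - θ₀ j) / σ ^ 2)) := by
  have mul_eq (y : Fin d → ℝ) : likelihoodRatio σ θ₀ θ y * likelihoodRatio σ θ₀ θ' y =
      ENNReal.ofReal (Real.exp (∑ j, (θ j - θ₀ j) * (θ' j - θ₀ j) / σ ^ 2)) *
        likelihoodRatio σ θ₀ (θ + θ' - θ₀) y := by
    unfold likelihoodRatio
    rw [← ENNReal.ofReal_mul (Real.exp_pos _).le, ← ENNReal.ofReal_mul (Real.exp_pos _).le,
      ← Real.exp_add, ← Real.exp_add, ← Finset.sum_add_distrib, ← Finset.sum_add_distrib]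
    congr 2
    refine Finset.sum_congr rfl fun j _ => ?_
    simp only [Pi.add_apply, Pi.sub_apply]
    field_simp
    ring
  simp_rw [mul_eq]
  rw [lintegral_const_mul' _ _ ENNReal.ofReal_ne_top, lintegral_likelihoodRatio hσ, mul_one]

end GaussianShift

/-! ### Fuzzy hypotheses -/

section FuzzyHypotheses

variable {α ι : Type*} [MeasurableSpace α] [MeasurableSpace ι]

theorem lintegral_mul_le_rpow_half_mul_rpow_half (μ : Measure α) {f g : α → ℝ≥0∞}
    (hf : AEMeasurable f μ) (hg : AEMeasurable g μ) :
    ∫⁻ x, f x * g x ∂μ ≤ (∫⁻ x, f x ^ 2 ∂μ) ^ (1 / 2 : ℝ) * (∫⁻ x, g x ^ 2 ∂μ) ^ (1 / 2 : ℝ) := by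
  simpa using ENNReal.lintegral_mul_le_Lp_mul_Lq μ Real.HolderConjugate.two_two hf hg

theorem ofReal_abs_sq (x : ℝ) : ENNReal.ofReal |x| ^ 2 = ENNReal.ofReal (x ^ 2) := by
  rw [← ENNReal.ofReal_pow (abs_nonneg x), sq_abs]

theorem ofReal_le_lintegral_abs_add_rpow_half (P : Measure α) [IsProbabilityMeasure P]
    {f : α → ℝ} (hf : Measurable f) {t₀ t Δ : ℝ} (hΔ : Δ ≤ |t - t₀|) :
    ENNReal.ofReal Δ ≤ ∫⁻ y, ENNReal.ofReal |f y - t₀| ∂P +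
      (∫⁻ y, ENNReal.ofReal ((f y - t) ^ 2) ∂P) ^ (1 / 2 : ℝ) := by
  have jensen : ∫⁻ y, ENNReal.ofReal |f y - t| ∂P ≤
      (∫⁻ y, ENNReal.ofReal ((f y - t) ^ 2) ∂P) ^ (1 / 2 : ℝ) := by
    simpa [ofReal_abs_sq] using lintegral_mul_le_rpow_half_mul_rpow_half P
      (f := fun y => ENNReal.ofReal |f y - t|) (g := 1) (by fun_prop) (by fun_prop)
  calc ENNReal.ofReal Δ = ∫⁻ _, ENNReal.ofReal Δ ∂P := by simp
    _ ≤ ∫⁻ y, (ENNReal.ofReal |f y - t₀| + ENNReal.ofReal |f y - t|) ∂P := by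
        gcongr with y
        rw [← ENNReal.ofReal_add (abs_nonneg _) (abs_nonneg _)]
        refine ENNReal.ofReal_le_ofReal (hΔ.trans ?_)
        rw [abs_sub_comm (f y) t, add_comm]
        exact abs_sub_le _ _ _
    _ = ∫⁻ y, ENNReal.ofReal |f y - t₀| ∂P + ∫⁻ y, ENNReal.ofReal |f y - t| ∂P :=
        lintegral_add_left (by fun_prop) _
    _ ≤ _ := by gcongr

variable (μ : Measure α) [SFinite μ] (π : Measure ι) {G : ι → α → ℝ≥0∞}

theorem lintegral_sq_lintegral [SFinite π] (hG : Measurable (Function.uncurry G)) :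
    ∫⁻ y, (∫⁻ i, G i y ∂π) ^ 2 ∂μ = ∫⁻ i, ∫⁻ j, ∫⁻ y, G i y * G j y ∂μ ∂π ∂π := by
  have hGy (y : α) : Measurable fun i => G i y := hG.of_uncurry_right
  calc ∫⁻ y, (∫⁻ i, G i y ∂π) ^ 2 ∂μ
      = ∫⁻ y, ∫⁻ i, ∫⁻ j, G i y * G j y ∂π ∂π ∂μ := by
        simp_rw [sq, ← lintegral_mul_const _ (hGy _), ← lintegral_const_mul _ (hGy _)]
    _ = ∫⁻ i, ∫⁻ y, ∫⁻ j, G i y * G j y ∂π ∂μ ∂π :=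
        lintegral_lintegral_swap (Measurable.lintegral_prod_right' (f := fun p : (α × ι) × ι =>
          G p.1.2 p.1.1 * G p.2 p.1.1) (by fun_prop)).aemeasurable
    _ = ∫⁻ i, ∫⁻ j, ∫⁻ y, G i y * G j y ∂μ ∂π ∂π :=
        lintegral_congr fun i => lintegral_lintegral_swap (by fun_prop)

theorem lintegral_lintegral_mul_le_rpow_half_mul_rpow_half [SFinite π]
    (hG : Measurable (Function.uncurry G)) {e : α → ℝ≥0∞} (he : Measurable e) :
    ∫⁻ i, ∫⁻ y, G i y * e y ∂μ ∂π ≤ (∫⁻ y, e y ^ 2 ∂μ) ^ (1 / 2 : ℝ) *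
      (∫⁻ i, ∫⁻ j, ∫⁻ y, G i y * G j y ∂μ ∂π ∂π) ^ (1 / 2 : ℝ) :=
  calc ∫⁻ i, ∫⁻ y, G i y * e y ∂μ ∂π
      = ∫⁻ y, e y * ∫⁻ i, G i y ∂π ∂μ := by
        rw [lintegral_lintegral_swap (by fun_prop)]
        simp_rw [mul_comm _ (e _)]
        exact lintegral_congr fun y => lintegral_const_mul _ hG.of_uncurry_right
    _ ≤ (∫⁻ y, e y ^ 2 ∂μ) ^ (1 / 2 : ℝ) * (∫⁻ y, (∫⁻ i, G i y ∂π) ^ 2 ∂μ) ^ (1 / 2 : ℝ) :=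
        lintegral_mul_le_rpow_half_mul_rpow_half μ he.aemeasurable
          hG.lintegral_prod_left'.aemeasurable
    _ = _ := by rw [lintegral_sq_lintegral μ π hG]

theorem ofReal_div_sq_le_of_ofReal_le_rpow_half_mul {x c : ℝ} {R : ℝ≥0∞} (hx : 0 ≤ x) (hc : 0 < c)
    (h : ENNReal.ofReal x ≤ R ^ (1 / 2 : ℝ) * ENNReal.ofReal c) :
    ENNReal.ofReal ((x / c) ^ 2) ≤ R :=
  calc ENNReal.ofReal ((x / c) ^ 2) = ENNReal.ofReal (x / c) ^ 2 :=
        ENNReal.ofReal_pow (by positivity) 2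
    _ ≤ (R ^ (1 / 2 : ℝ)) ^ 2 := by
        gcongr
        rw [ENNReal.ofReal_div_of_pos hc]
        exact ENNReal.div_le_of_le_mul h
    _ = R := by
        rw [← ENNReal.rpow_natCast, ← ENNReal.rpow_mul]
        norm_num

theorem ofReal_sq_le_of_fuzzy_hypotheses [IsProbabilityMeasure π]
    (hG : Measurable (Function.uncurry G)) (hG₁ : ∀ i, ∫⁻ y, G i y ∂μ = 1)
    {f : α → ℝ} (hf : Measurable f) {t₀ Δ C : ℝ} {t : ι → ℝ} {R : ℝ≥0∞} (hΔ₀ : 0 ≤ Δ) (hC₀ : 0 ≤ C)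
    (hΔ : ∀ᵐ i ∂π, Δ ≤ |t i - t₀|)
    (hC : ∫⁻ i, ∫⁻ j, ∫⁻ y, G i y * G j y ∂μ ∂π ∂π ≤ ENNReal.ofReal (C ^ 2))
    (hR₀ : ∫⁻ y, ENNReal.ofReal ((f y - t₀) ^ 2) ∂μ ≤ R)
    (hR : ∀ᵐ i ∂π, ∫⁻ y, ENNReal.ofReal ((f y - t i) ^ 2) ∂(μ.withDensity (G i)) ≤ R) :
    ENNReal.ofReal ((Δ / (1 + C)) ^ 2) ≤ R := by
  let e : α → ℝ≥0∞ := fun y => ENNReal.ofReal |f y - t₀|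
  have he : Measurable e := by fun_prop
  have separation : ∀ᵐ i ∂π, ENNReal.ofReal Δ ≤ ∫⁻ y, G i y * e y ∂μ + R ^ (1 / 2 : ℝ) := by
    filter_upwards [hΔ, hR] with i hΔi hRi
    have : IsProbabilityMeasure (μ.withDensity (G i)) :=
      ⟨by rw [withDensity_apply _ MeasurableSet.univ, setLIntegral_univ, hG₁]⟩
    refine (ofReal_le_lintegral_abs_add_rpow_half (μ.withDensity (G i)) hf hΔi).trans ?_
    rw [lintegral_withDensity_eq_lintegral_mul _ hG.of_uncurry_left he]
    gcongr
    exact le_rfl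
  have mixture : ∫⁻ i, ∫⁻ y, G i y * e y ∂μ ∂π ≤ R ^ (1 / 2 : ℝ) * ENNReal.ofReal C := by
    calc ∫⁻ i, ∫⁻ y, G i y * e y ∂μ ∂π
        ≤ (∫⁻ y, e y ^ 2 ∂μ) ^ (1 / 2 : ℝ) *
            (∫⁻ i, ∫⁻ j, ∫⁻ y, G i y * G j y ∂μ ∂π ∂π) ^ (1 / 2 : ℝ) :=
          lintegral_lintegral_mul_le_rpow_half_mul_rpow_half μ π hG he
      _ ≤ R ^ (1 / 2 : ℝ) * ENNReal.ofReal (C ^ 2) ^ (1 / 2 : ℝ) := by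
          simp_rw [e, ofReal_abs_sq]
          gcongr
      _ = R ^ (1 / 2 : ℝ) * ENNReal.ofReal C := by
          rw [ENNReal.ofReal_rpow_of_nonneg (by positivity) (by norm_num), ← Real.sqrt_eq_rpow,
            Real.sqrt_sq hC₀]
  refine ofReal_div_sq_le_of_ofReal_le_rpow_half_mul hΔ₀ (by positivity) ?_
  calc ENNReal.ofReal Δ = ∫⁻ _, ENNReal.ofReal Δ ∂π := by simp
    _ ≤ ∫⁻ i, (∫⁻ y, G i y * e y ∂μ + R ^ (1 / 2 : ℝ)) ∂π := lintegral_mono_ae separation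
    _ = ∫⁻ i, ∫⁻ y, G i y * e y ∂μ ∂π + R ^ (1 / 2 : ℝ) := by
        rw [lintegral_add_right _ measurable_const, lintegral_const, measure_univ, mul_one]
    _ ≤ R ^ (1 / 2 : ℝ) * ENNReal.ofReal C + R ^ (1 / 2 : ℝ) := by gcongr
    _ = R ^ (1 / 2 : ℝ) * ENNReal.ofReal (1 + C) := by
        rw [ENNReal.ofReal_add zero_le_one hC₀, ENNReal.ofReal_one]
        ring

end FuzzyHypotheses

theorem le_minimaxRisk_of_prior {ι : Type*} [MeasurableSpace ι] (π : Measure ι)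
    [IsProbabilityMeasure π] {d : ℕ} {σ : ℝ} (hσ : σ ≠ 0) {T : (Fin d → ℝ) → ℝ}
    {Θ : Set (Fin d → ℝ)} {θ₀ : Fin d → ℝ} {θ : ι → Fin d → ℝ}
    (hθm : Measurable θ) (hθ₀ : θ₀ ∈ Θ) (hθ : ∀ᵐ i ∂π, θ i ∈ Θ) {Δ C : ℝ} (hΔ₀ : 0 ≤ Δ)
    (hC₀ : 0 ≤ C) (hΔ : ∀ᵐ i ∂π, Δ ≤ |T (θ i) - T θ₀|)
    (hC : ∫⁻ i, ∫⁻ j, ENNReal.ofReal (Real.exp (∑ k, (θ i k - θ₀ k) * (θ j k - θ₀ k) / σ ^ 2))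
      ∂π ∂π ≤ ENNReal.ofReal (C ^ 2)) :
    ENNReal.ofReal ((Δ / (1 + C)) ^ 2) ≤ minimaxRisk σ T Θ := by
  refine le_iInf₂ fun That hThat => ?_
  have risk_le {η : Fin d → ℝ} (hη : η ∈ Θ) : ∫⁻ y, ENNReal.ofReal ((That y - T η) ^ 2)
      ∂(obsLaw σ η) ≤ ⨆ θ ∈ Θ, sqRisk σ T That θ :=
    le_iSup₂ (f := fun θ _ => sqRisk σ T That θ) η hη
  refine ofReal_sq_le_of_fuzzy_hypotheses (obsLaw σ θ₀) π (t₀ := T θ₀) (t := fun i => T (θ i))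
    (measurable_likelihoodRatio σ θ₀ hθm) (fun i => lintegral_likelihoodRatio hσ _ _) hThat hΔ₀
    hC₀ hΔ ?_ (risk_le hθ₀) ?_
  · simpa only [lintegral_likelihoodRatio_mul_likelihoodRatio hσ] using hC
  · filter_upwards [hθ] with i hi
    rw [← obsLaw_eq_withDensity hσ]
    exact risk_le hi

/-! ### Priors with one spike per block -/

section Spikes

theorem mem_lqBall_iff {d : ℕ} {q r : ℝ} (hq : 0 < q) (hr : 0 ≤ r) {θ : Fin d → ℝ} :
    θ ∈ lqBall d q r ↔ ∑ i, |θ i| ^ q ≤ r ^ q := by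
  rw [lqBall, Set.mem_ofPred_eq, one_div]
  exact Real.rpow_inv_le_iff_of_pos (by positivity) hr hq

theorem zero_mem_lqBall {d : ℕ} {q r : ℝ} (hq : 0 < q) (hr : 0 ≤ r) :
    (0 : Fin d → ℝ) ∈ lqBall d q r := by
  simpa [mem_lqBall_iff hq hr, hq.ne'] using Real.rpow_nonneg hr q

variable {κ β : Type*} {d : ℕ} (e : κ × β ↪ Fin d) (a : ℝ)

/-- The vector of `ℝ^d` with one spike of height `a` in each block: `e` identifies part of the
coordinates with a family of blocks `β` indexed by `κ`, and `f l` is the position of the spike in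
the block `l`. -/
def spikes (f : κ → β) : Fin d → ℝ :=
  Function.extend (fun l => e (l, f l)) (fun _ => a) 0

theorem injective_embedding_graph (f : κ → β) : Function.Injective fun l => e (l, f l) :=
  e.injective.comp fun _ _ h => congrArg Prod.fst h

theorem spikes_apply [DecidableEq β] (f : κ → β) (l : κ) (j : β) :
    spikes e a f (e (l, j)) = if f l = j then a else 0 := by
  split_ifs with hj
  · subst hj
    exact (injective_embedding_graph e f).extend_apply _ _ l
  · refine Function.extend_apply' _ _ _ ?_
    rintro ⟨l', hl'⟩
    obtain ⟨rfl, rfl⟩ := Prod.ext_iff.1 (e.injective hl')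
    exact hj rfl

variable [Fintype κ]

theorem sum_spikes {M : Type*} [AddCommMonoid M] (f : κ → β) {φ : Fin d → ℝ → M}
    (hφ : ∀ k, φ k 0 = 0) : ∑ k, φ k (spikes e a f k) = ∑ l, φ (e (l, f l)) a := by
  classical
  refine (Fintype.sum_of_injective _ (injective_embedding_graph e f) _ _ (fun k hk => ?_)
    fun l => ?_).symm
  · rw [spikes, Function.extend_apply' _ _ _ hk, Pi.zero_apply, hφ]
  · rw [spikes_apply, if_pos rfl]

theorem quadFunctional_spikes (f : κ → β) :
    quadFunctional (spikes e a f) = Fintype.card κ * a ^ 2 := by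
  rw [quadFunctional, sum_spikes e a f (φ := fun _ t => t ^ 2) (by simp)]
  simp

theorem spikes_mem_lqBall {a q r : ℝ} (hq : 0 < q) (hr : 0 ≤ r)
    (h : Fintype.card κ * |a| ^ q ≤ r ^ q) (f : κ → β) : spikes e a f ∈ lqBall d q r := by
  rw [mem_lqBall_iff hq hr, sum_spikes e a f (φ := fun _ t => |t| ^ q) (by simp [hq.ne'])]
  simpa using h

theorem exp_sum_spikes_mul_spikes [DecidableEq β] (σ : ℝ) (f g : κ → β) :
    ENNReal.ofReal (Real.exp (∑ k, spikes e a f k * spikes e a g k / σ ^ 2)) =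
      ∏ l, if f l = g l then 1 + ENNReal.ofReal (Real.exp (a ^ 2 / σ ^ 2) - 1) else 1 := by
  rw [sum_spikes e a f (φ := fun k t => t * spikes e a g k / σ ^ 2) (by simp), Real.exp_sum,
    ENNReal.ofReal_prod_of_nonneg fun _ _ => (Real.exp_pos _).le]
  refine Finset.prod_congr rfl fun l _ => ?_
  rw [spikes_apply]
  by_cases h : f l = g l
  · rw [if_pos h, if_pos h.symm, ← ENNReal.ofReal_one, ← ENNReal.ofReal_add zero_le_one
      (sub_nonneg.2 (Real.one_le_exp (by positivity))), add_sub_cancel, sq a]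
  · rw [if_neg h, if_neg (Ne.symm h), mul_zero, zero_div, Real.exp_zero, ENNReal.ofReal_one]

variable [Fintype β] [Nonempty β] [MeasurableSpace β] [MeasurableSingletonClass β]

theorem lintegral_uniformOn_ite_eq [DecidableEq β] (i : β) (ε : ℝ≥0∞) :
    ∫⁻ j, (if i = j then 1 + ε else 1) ∂(uniformOn (Set.univ : Set β)) =
      1 + ε / Fintype.card β := by
  have split (j : β) :
      (if i = j then 1 + ε else 1) = 1 + ({i} : Set β).indicator (fun _ => ε) j := by
    by_cases h : i = j <;> simp [h, eq_comm (a := j)]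
  simp_rw [split]
  rw [lintegral_add_left measurable_const, lintegral_indicator_const (measurableSet_singleton i),
    uniformOn_univ, Measure.count_singleton, lintegral_one, measure_univ, mul_one_div]

theorem lintegral_lintegral_exp_sum_spikes (σ : ℝ) :
    ∫⁻ f, ∫⁻ g, ENNReal.ofReal (Real.exp (∑ k, spikes e a f k * spikes e a g k / σ ^ 2))
        ∂(Measure.pi fun _ : κ => uniformOn (Set.univ : Set β))
        ∂(Measure.pi fun _ : κ => uniformOn (Set.univ : Set β)) =
      (1 + ENNReal.ofReal (Real.exp (a ^ 2 / σ ^ 2) - 1) / Fintype.card β) ^ Fintype.card κ := by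
  classical
  simp_rw [exp_sum_spikes_mul_spikes]
  have inner (f : κ → β) := lintegral_pi_prod_eval (fun _ : κ => uniformOn (Set.univ : Set β))
    (f := fun l j => if f l = j then 1 + ENNReal.ofReal (Real.exp (a ^ 2 / σ ^ 2) - 1) else 1)
    fun _ => measurable_of_finite _
  simp_rw [inner, lintegral_uniformOn_ite_eq]
  simp

end Spikes

theorem one_add_div_pow_le_exp_sq {E b : ℝ} {s : ℕ} (hE : 0 ≤ E) (hb : 0 < b) (h : s * E ≤ 2 * b) :
    (1 + E / b) ^ s ≤ Real.exp 1 ^ 2 :=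
  calc (1 + E / b) ^ s ≤ Real.exp (E / b) ^ s := by
        gcongr
        linarith [Real.add_one_le_exp (E / b)]
    _ = Real.exp (s * E / b) := by rw [← Real.exp_nat_mul, mul_div_assoc]
    _ ≤ Real.exp 2 := Real.exp_le_exp.2 ((div_le_iff₀ hb).2 h)
    _ = Real.exp 1 ^ 2 := by rw [← Real.exp_nat_mul]; norm_num

theorem le_minimaxRisk_of_blocks {d s b : ℕ} (hb : 0 < b) (hsb : s * b ≤ d) {a q r σ : ℝ}
    (hσ : σ ≠ 0) (hq : 0 < q) (hr : 0 ≤ r) (har : s * |a| ^ q ≤ r ^ q)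
    (hχ : s * (Real.exp (a ^ 2 / σ ^ 2) - 1) ≤ 2 * b) :
    ENNReal.ofReal ((s * a ^ 2 / (1 + Real.exp 1)) ^ 2) ≤
      minimaxRisk σ quadFunctional (lqBall d q r) := by
  let e : Fin s × Fin b ↪ Fin d := finProdFinEquiv.toEmbedding.trans (Fin.castLEEmb hsb)
  have : NeZero b := ⟨hb.ne'⟩
  have hb' : (0 : ℝ) < b := by exact_mod_cast hb
  have hE : 0 ≤ Real.exp (a ^ 2 / σ ^ 2) - 1 := sub_nonneg.2 (Real.one_le_exp (by positivity))
  have χ_le : (1 + ENNReal.ofReal (Real.exp (a ^ 2 / σ ^ 2) - 1) / b) ^ s ≤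
      ENNReal.ofReal (Real.exp 1 ^ 2) := by
    rw [← ENNReal.ofReal_natCast b, ← ENNReal.ofReal_div_of_pos hb', ← ENNReal.ofReal_one,
      ← ENNReal.ofReal_add zero_le_one (by positivity), ← ENNReal.ofReal_pow (by positivity)]
    exact ENNReal.ofReal_le_ofReal (one_add_div_pow_le_exp_sq hE hb' hχ)
  refine le_minimaxRisk_of_prior (Measure.pi fun _ : Fin s => uniformOn (Set.univ : Set (Fin b)))
    hσ (θ₀ := 0) (θ := spikes e a) (measurable_of_finite _) (zero_mem_lqBall hq hr)
    (.of_forall (spikes_mem_lqBall e hq hr (by simpa using har))) (by positivity)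
    (Real.exp_pos 1).le (.of_forall fun f => ?_) ?_
  · rw [quadFunctional_spikes, Fintype.card_fin]
    simp [quadFunctional]
  · simpa [lintegral_lintegral_exp_sum_spikes e a σ] using χ_le

/-! ### The regimes of the rate -/

section Regimes

variable {d s : ℕ} {q r σ : ℝ}

theorem sparsityIneq_one_iff :
    SparsityIneq σ q r d 1 ↔ σ ^ 2 * Real.log (1 + d) ≤ r ^ 2 := by
  simp [SparsityIneq]

theorem natCast_le_effSparsity_iff :
    (s : ℕ∞) ≤ effSparsity σ q r d ↔ ∀ k, 1 ≤ k → k ≤ s → SparsityIneq σ q r d k := by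
  refine ⟨fun h k hk hks => ?_, fun h => le_iSup₂ (f := fun (s : ℕ) _ => (s : ℕ∞)) s h⟩
  have hk_lt : ((k - 1 : ℕ) : ℕ∞) < effSparsity σ q r d :=
    lt_of_lt_of_le (by exact_mod_cast show k - 1 < s by omega) h
  obtain ⟨t, ht, hkt⟩ : ∃ t ∈ {t : ℕ | ∀ k, 1 ≤ k → k ≤ t → SparsityIneq σ q r d k},
      ((k - 1 : ℕ) : ℕ∞) < t := by
    simpa only [effSparsity, lt_iSup_iff, exists_prop] using hk_lt
  have hkt' : k - 1 < t := by exact_mod_cast hkt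
  exact ht k hk (by omega)

theorem effSparsity_ne_zero_iff : effSparsity σ q r d ≠ 0 ↔ SparsityIneq σ q r d 1 := by
  rw [← Order.one_le_iff_ne_zero, ← Nat.cast_one, natCast_le_effSparsity_iff]
  exact ⟨fun h => h 1 le_rfl le_rfl, fun h k hk hk' => (le_antisymm hk' hk) ▸ h⟩

/-- The absolute constant of the lower bound: `1 + e` comes from the bound `e²` on the second moment
of the mixture likelihood ratios, and `log 2 / 2` from comparing the separation of the functional
with the square root of the rate. -/
def rateConst : ℝ := (Real.log 2 / 2 / (1 + Real.exp 1)) ^ 2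

theorem rateConst_pos : 0 < rateConst := by
  have := Real.log_pos one_lt_two
  unfold rateConst
  positivity

theorem ofReal_rateConst_mul_sq_le {x Δ : ℝ} {R : ℝ≥0∞} (hx : 0 ≤ x) (hΔ : Real.log 2 / 2 * x ≤ Δ)
    (hR : ENNReal.ofReal ((Δ / (1 + Real.exp 1)) ^ 2) ≤ R) :
    ENNReal.ofReal (rateConst * x ^ 2) ≤ R := by
  have := Real.log_pos one_lt_two
  refine (ENNReal.ofReal_le_ofReal ?_).trans hR
  rw [rateConst, ← mul_pow, div_mul_eq_mul_div]
  gcongr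

theorem log_two_div_two_le_half : Real.log 2 / 2 ≤ 1 / 2 := by
  linarith [Real.log_two_lt_d9]

theorem le_minimaxRisk_of_not_sparsityIneq_one (hd : 1 ≤ d) (hq : 0 < q) (hr : 0 ≤ r) (hσ : σ ≠ 0)
    (h : ¬ SparsityIneq σ q r d 1) :
    ENNReal.ofReal (rateConst * r ^ 4) ≤ minimaxRisk σ quadFunctional (lqBall d q r) := by
  have exp_le : Real.exp (r ^ 2 / σ ^ 2) ≤ 1 + d := by
    rw [sparsityIneq_one_iff, not_le] at h
    rw [← Real.le_log_iff_exp_le (by positivity), div_le_iff₀' (by positivity)]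
    exact h.le
  rw [show r ^ 4 = (r ^ 2) ^ 2 by ring]
  refine ofReal_rateConst_mul_sq_le (sq_nonneg r) ?_
    (le_minimaxRisk_of_blocks (s := 1) (b := d) (a := r) hd (by simp) hσ hq hr
      (by simp [abs_of_nonneg hr]) ?_)
  · nlinarith [log_two_div_two_le_half, sq_nonneg r]
  · linarith [Nat.cast_nonneg (α := ℝ) d, exp_le]

theorem single_mem_lqBall (hq : 0 < q) (k : Fin d) {t : ℝ} (ht : |t| ≤ r) :
    (Pi.single k t : Fin d → ℝ) ∈ lqBall d q r := by
  rw [mem_lqBall_iff hq ((abs_nonneg t).trans ht),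
    Finset.sum_eq_single k (fun i _ hi => by simp [hi, hq.ne']) (by simp), Pi.single_eq_same]
  gcongr

theorem quadFunctional_single (k : Fin d) (t : ℝ) :
    quadFunctional (Pi.single k t : Fin d → ℝ) = t ^ 2 := by
  rw [quadFunctional, Finset.sum_eq_single k (fun i _ hi => by simp [hi]) (by simp),
    Pi.single_eq_same]

theorem le_minimaxRisk_of_sparsityIneq_one (hd : 1 ≤ d) (hq : 0 < q) (hr : 0 ≤ r) (hσ : 0 < σ)
    (h : SparsityIneq σ q r d 1) :
    ENNReal.ofReal (rateConst * (σ ^ 2 * r ^ 2)) ≤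
      minimaxRisk σ quadFunctional (lqBall d q r) := by
  have hσr : σ / 2 ≤ r := by
    have log_le : Real.log 2 ≤ Real.log (1 + d) :=
      Real.log_le_log two_pos (by linarith [show (1 : ℝ) ≤ d from mod_cast hd])
    refine abs_le_of_sq_le_sq' ?_ hr |>.2
    nlinarith [Real.log_two_gt_d9, sparsityIneq_one_iff.1 h, sq_nonneg σ]
  let k : Fin d := ⟨0, hd⟩
  rw [← mul_pow]
  refine ofReal_rateConst_mul_sq_le (Δ := σ * r / 2) (by positivity) ?_
    (le_minimaxRisk_of_prior (Measure.dirac ()) hσ.ne' (θ₀ := Pi.single k (r - σ / 2))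
      (θ := fun _ => Pi.single k r) measurable_const (single_mem_lqBall hq k ?_)
      (.of_forall fun _ => single_mem_lqBall hq k (abs_of_nonneg hr).le) (by positivity)
      (Real.exp_pos 1).le (.of_forall fun _ => ?_) ?_)
  · nlinarith [log_two_div_two_le_half, mul_nonneg hσ.le hr]
  · rw [abs_of_nonneg (by linarith)]
    linarith
  · rw [quadFunctional_single, quadFunctional_single]
    exact le_trans (by nlinarith) (le_abs_self _)
  · rw [Finset.sum_eq_single k (fun i _ hi => by simp [hi]) (by simp)]
    simp only [Pi.single_eq_same, lintegral_const, measure_univ, mul_one]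
    refine ENNReal.ofReal_le_ofReal ?_
    rw [← Real.exp_nat_mul, show (r - (r - σ / 2)) * (r - (r - σ / 2)) / σ ^ 2 = 1 / 4 by
      field_simp; ring]
    exact Real.exp_le_exp.2 (by norm_num)

theorem log_one_add_div_sq_nonneg (d s : ℕ) : 0 ≤ Real.log (1 + d / (s : ℝ) ^ 2) :=
  Real.log_nonneg (le_add_of_nonneg_right (by positivity))

theorem mul_rpow_le_of_sparsityIneq (hq : 0 < q) (hr : 0 ≤ r) (hs : 0 < s)
    (h : SparsityIneq σ q r d s) :
    s * |σ * √(Real.log (1 + d / (s : ℝ) ^ 2))| ^ q ≤ r ^ q := by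
  have hs' : (0 : ℝ) < s := by exact_mod_cast hs
  have height_le : |σ * √(Real.log (1 + d / (s : ℝ) ^ 2))| ≤ r * (s : ℝ) ^ (-(1 / q)) := by
    refine abs_le_of_sq_le_sq ?_ (by positivity)
    rw [mul_pow, mul_pow, Real.sq_sqrt (log_one_add_div_sq_nonneg d s),
      ← Real.rpow_mul_natCast hs'.le]
    rwa [show -(1 / q) * (2 : ℕ) = -(2 / q) by push_cast; ring]
  calc s * |σ * √(Real.log (1 + d / (s : ℝ) ^ 2))| ^ q
      ≤ s * (r * (s : ℝ) ^ (-(1 / q))) ^ q := by gcongr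
    _ = s * (r ^ q * (s : ℝ) ^ (-1 : ℝ)) := by
        rw [Real.mul_rpow hr (by positivity), ← Real.rpow_mul hs'.le, neg_mul,
          one_div_mul_cancel hq.ne']
    _ = r ^ q := by rw [Real.rpow_neg_one]; field_simp

theorem le_minimaxRisk_of_sparsityIneq (hq : 0 < q) (hr : 0 ≤ r) (hσ : 0 < σ) (hs : 0 < s)
    (hsd : s ^ 2 ≤ d) (h : SparsityIneq σ q r d s) :
    ENNReal.ofReal ((σ ^ 2 * s * Real.log (1 + d / (s : ℝ) ^ 2) / (1 + Real.exp 1)) ^ 2) ≤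
      minimaxRisk σ quadFunctional (lqBall d q r) := by
  have hs' : (0 : ℝ) < s := by exact_mod_cast hs
  have hb : s ≤ d / s := (Nat.le_div_iff_mul_le hs).2 (by rwa [← sq])
  set L := Real.log (1 + d / (s : ℝ) ^ 2) with hL
  have ha : (σ * √L) ^ 2 = σ ^ 2 * L := by
    rw [mul_pow, Real.sq_sqrt (log_one_add_div_sq_nonneg d s)]
  have exp_eq : Real.exp ((σ * √L) ^ 2 / σ ^ 2) = 1 + d / (s : ℝ) ^ 2 := by
    rw [ha, mul_div_cancel_left₀ _ (by positivity), hL, Real.exp_log (by positivity)]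
  have d_le : (d : ℝ) ≤ s * (2 * (d / s : ℕ)) := by
    have : d ≤ s * (2 * (d / s)) := by
      nlinarith [Nat.div_add_mod d s, Nat.mod_lt d hs]
    exact_mod_cast this
  have hχ : s * (Real.exp ((σ * √L) ^ 2 / σ ^ 2) - 1) ≤ 2 * (d / s : ℕ) := by
    rw [exp_eq, add_sub_cancel_left]
    calc s * (d / (s : ℝ) ^ 2) = d / s := by field_simp
      _ ≤ _ := (div_le_iff₀' hs').2 d_le
  convert le_minimaxRisk_of_blocks (hs.trans_le hb) (Nat.mul_div_le d s) hσ.ne' hq hr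
    (mul_rpow_le_of_sparsityIneq hq hr hs h) hχ using 4
  rw [ha]
  ring

theorem le_minimaxRisk_of_sqrt_lt_effSparsity (hd : 1 ≤ d) (hq : 0 < q) (hr : 0 ≤ r) (hσ : 0 < σ)
    (h : ENNReal.ofReal √d < effSparsity σ q r d) :
    ENNReal.ofReal (rateConst * (σ ^ 4 * d)) ≤ minimaxRisk σ quadFunctional (lqBall d q r) := by
  have hs : 0 < d.sqrt := Nat.sqrt_pos.2 hd
  have sqrt_le : (d.sqrt : ℕ∞) ≤ effSparsity σ q r d := by
    rw [← ENat.toENNReal_le, ENat.toENNReal_coe, ← ENNReal.ofReal_natCast]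
    exact (ENNReal.ofReal_le_ofReal Real.nat_sqrt_le_real_sqrt).trans h.le
  have log_two_le : Real.log 2 ≤ Real.log (1 + d / (d.sqrt : ℝ) ^ 2) := by
    have : 1 ≤ d / (d.sqrt : ℝ) ^ 2 := by
      rw [one_le_div (by positivity)]
      exact_mod_cast Nat.sqrt_le' d
    exact Real.log_le_log two_pos (by linarith)
  have sqrt_le_two_mul : √d ≤ 2 * d.sqrt := by
    have := Real.real_sqrt_le_nat_sqrt_succ (a := d)
    linarith [show (1 : ℝ) ≤ d.sqrt from mod_cast hs]
  rw [show σ ^ 4 * d = (σ ^ 2 * √d) ^ 2 by rw [mul_pow, Real.sq_sqrt d.cast_nonneg]; ring]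
  refine ofReal_rateConst_mul_sq_le (by positivity) ?_ (le_minimaxRisk_of_sparsityIneq hq hr hσ hs
    (Nat.sqrt_le' d) (natCast_le_effSparsity_iff.1 sqrt_le _ hs le_rfl))
  have := Real.log_pos one_lt_two
  calc Real.log 2 / 2 * (σ ^ 2 * √d) ≤ Real.log 2 / 2 * (σ ^ 2 * (2 * d.sqrt)) := by gcongr
    _ = σ ^ 2 * d.sqrt * Real.log 2 := by ring
    _ ≤ _ := by gcongr

theorem le_minimaxRisk_of_effSparsity_le_sqrt (hq : 0 < q) (hr : 0 ≤ r) (hσ : 0 < σ)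
    (h₀ : effSparsity σ q r d ≠ 0) (h : (effSparsity σ q r d : ℝ≥0∞) ≤ ENNReal.ofReal √d) :
    let m := (effSparsity σ q r d).toNat
    ENNReal.ofReal (rateConst * (σ ^ 4 * m ^ 2 * Real.log (1 + d / (m : ℝ) ^ 2) ^ 2)) ≤
      minimaxRisk σ quadFunctional (lqBall d q r) := by
  intro m
  have hm : (m : ℕ∞) = effSparsity σ q r d :=
    ENat.natCast_toNat fun h_top => by simp [h_top] at h
  have hm₀ : 0 < m := Nat.pos_of_ne_zero fun hm₀ => h₀ (by rw [← hm, hm₀, Nat.cast_zero])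
  have hmd : m ^ 2 ≤ d := by
    rw [← hm, ENat.toENNReal_coe, ← ENNReal.ofReal_natCast,
      ENNReal.ofReal_le_ofReal_iff (Real.sqrt_nonneg _), Real.le_sqrt' (by exact_mod_cast hm₀)] at h
    exact_mod_cast h
  have := log_one_add_div_sq_nonneg d m
  rw [show σ ^ 4 * m ^ 2 * Real.log (1 + d / (m : ℝ) ^ 2) ^ 2 =
    (σ ^ 2 * m * Real.log (1 + d / (m : ℝ) ^ 2)) ^ 2 by ring]
  refine ofReal_rateConst_mul_sq_le (by positivity) ?_ (le_minimaxRisk_of_sparsityIneq hq hr hσ hm₀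
    hmd (natCast_le_effSparsity_iff.1 hm.le m hm₀ le_rfl))
  exact mul_le_of_le_one_left (by positivity) (by linarith [log_two_div_two_le_half])

theorem ofReal_mul_max_le {c x y : ℝ} {R : ℝ≥0∞} (hc : 0 ≤ c) (hx : ENNReal.ofReal (c * x) ≤ R)
    (hy : ENNReal.ofReal (c * y) ≤ R) : ENNReal.ofReal (c * max x y) ≤ R := by
  rw [mul_max_of_nonneg _ _ hc, ENNReal.ofReal_max]
  exact max_le hx hy

end Regimes

end SparseSequence

end

open SparseSequence in
theorem theorem5_general :
    ∃ c : ℝ, 0 < c ∧ ∀ (q : ℝ) (d : ℕ) (r σ : ℝ), 0 < q → 1 ≤ d → 0 < r → 0 < σ →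
      ENNReal.ofReal (c * quadRate σ q r d) ≤ minimaxRisk σ quadFunctional (lqBall d q r) := by
  refine ⟨rateConst, rateConst_pos, fun q d r σ hq hd hr hσ => ?_⟩
  have two_point_bound (hm : effSparsity σ q r d ≠ 0) :=
    le_minimaxRisk_of_sparsityIneq_one hd hq hr.le hσ (effSparsity_ne_zero_iff.1 hm)
  simp only [quadRate]
  split_ifs with hm hdense
  · exact le_minimaxRisk_of_not_sparsityIneq_one hd hq hr.le hσ.ne'
      fun h => effSparsity_ne_zero_iff.2 h hm
  · exact ofReal_mul_max_le rateConst_pos.le (two_point_bound hm)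
      (le_minimaxRisk_of_sqrt_lt_effSparsity hd hq hr.le hσ hdense)
  · exact ofReal_mul_max_le rateConst_pos.le (two_point_bound hm)
      (le_minimaxRisk_of_effSparsity_le_sqrt hq hr.le hσ hm (not_lt.1 hdense))

theorem theorem5 (q : ℝ) (hq0 : 0 < q) (hq2 : q < 2) :
    ∃ c : ℝ, 0 < c ∧ ∀ (d : ℕ) (r σ : ℝ), 1 ≤ d → 0 < r → 0 < σ →
      ENNReal.ofReal (c * SparseSequence.quadRate σ q r d) ≤
        SparseSequence.minimaxRisk σ SparseSequence.quadFunctional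
          (SparseSequence.lqBall d q r) := by
  obtain ⟨c, hc, bound⟩ := theorem5_general
  exact ⟨c, hc, fun d r σ => bound q d r σ hq0⟩
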